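/- Hypergraphs are finite and may have repeated edges. For a hypergraph $\mathcal H$ on a finite vertex set $V$ and $A\subseteq V$, let $d(A)$ be the number of edges of $\mathcal H$ containing $A$, and for an integer $j\ge 0$ let $M_j(A)$ be the number of edges $S\in\mathcal H$ with $|A\cap S|\ge j$ (both counted with multiplicity). For a real number $0<q\le 1$ and positive integers $s_1>\dots>s_L$, call $\mathcal H$ $(q;s_1,\dots,s_L)$-spread if $\mathcal H$ has at least one edge, every edge has size at most $s_1$, and, for every $A\subseteq V$ with $d(A)>0$ and every $1\le i<L$ with $s_i\ge |A|\ge s_{i+1}$, one has $M_j(A)\le q^j|\mathcal H|$ for all $j\ge s_{i+1}$. **Theorem.** Let $\ell\ge 1$ and let $\mathcal H$ be an $r_1$-uniform $(q;r_1,\dots,r_\ell,1)$-spread hypergraph on $V$ (so $r_1>\dots>r_\ell>1$), and let $C\ge 8$ be a real number. Let $W$ be chosen uniformly at random among the subsets of $V$ of size $2C\ell q|V|$, where this number is rounded up or down (either choice) to an integer, and replaced by $|V|$ if it then exceeds $|V|$. Then $$\Pr[W\text{ contains an edge of }\mathcal H]\ \ge\ 1-6\ell^2 (C/4)^{-r_\ell/2}-\frac{40}{C\ell},$$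 and, for every $1\le i\le \ell$ with $4r_i\le C\ell$, $$\Pr[W\text{ contains an edge of }\mathcal H]\ \ge\ 1-6\ell^2 (C/4)^{-r_i/2}-2e^{-C\ell/(4r_i)}.$$ -/

import Mathlib

/-! Hypergraphs with repeated edges on a finite vertex set `V`: an edge family `H : E → Finset V`
indexed by a finite type `E`, so that `|H|` is `Fintype.card E` and edges count with multiplicity. -/

namespace MultiHypergraph

variable {V E : Type*} [DecidableEq V] [Fintype E]

/-- The degree `d(A)` of a vertex set `A`: the number of edges containing `A`. -/
def degree (H : E → Finset V) (A : Finset V) : ℕ :=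
  (Finset.univ.filter fun e => A ⊆ H e).card

/-- `M_j(A)`: the number of edges meeting `A` in at least `j` vertices. -/
def meetCount (H : E → Finset V) (j : ℕ) (A : Finset V) : ℕ :=
  (Finset.univ.filter fun e => j ≤ (A ∩ H e).card).card

/-- Every edge has exactly `k` vertices. -/
def IsUniform (H : E → Finset V) (k : ℕ) : Prop :=
  ∀ e, (H e).card = k

/-- Every edge has at most `k` vertices. -/
def IsBounded (H : E → Finset V) (k : ℕ) : Prop :=
  ∀ e, (H e).card ≤ k

/-- `H` is `(q; r 1, …, r L)`-spread, where `0 < q ≤ 1` and `r 1 > ⋯ > r L` are positive integers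
(only the values of `r` at `1, …, L` matter). -/
structure IsSpread (H : E → Finset V) (q : ℝ) (r : ℕ → ℕ) (L : ℕ) : Prop where
  one_le_length : 1 ≤ L
  q_pos : 0 < q
  q_le_one : q ≤ 1
  r_pos : ∀ i, 1 ≤ i → i ≤ L → 0 < r i
  r_strictAnti : ∀ i, 1 ≤ i → i < L → r (i + 1) < r i
  nonempty : Nonempty E
  bounded : IsBounded H (r 1)
  meetCount_le : ∀ A : Finset V, 0 < degree H A →
    ∀ i, 1 ≤ i → i < L → A.card ≤ r i → r (i + 1) ≤ A.card →
      ∀ j, r (i + 1) ≤ j → (meetCount H j A : ℝ) ≤ q ^ j * (Fintype.card E : ℝ)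

/-- The probability that a uniformly random `m`-element subset of `V` contains an edge of `H`
(meaningful for `m ≤ |V|`). -/
noncomputable def probContainsEdge [Fintype V] (H : E → Finset V) (m : ℕ) : ℝ :=
  (((Finset.univ : Finset V).powersetCard m).filter fun W => ∃ e, H e ⊆ W).card /
    ((Finset.univ : Finset V).powersetCard m).card

end MultiHypergraph

/-! Random sets containing an edge of a spread hypergraph. The random set is replaced by one that keeps
each vertex independently; such sets shrink the edges in stages, Janson's inequality handles the
last stage, and the local LYM inequality transfers the bound to sets of fixed size. -/

namespace MultiHypergraph

open Finset

/-! The random set is compared with a union of independent binomial sets: `t - 1` of density `C * q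
/ 4` and a last one of density `3 / 4 * (C * ℓ * q)`. Here `t = ℓ` for the first bound and `t = i`
for the second. The total density is at most `C * ℓ * q`, half the target, so passing to fixed size
costs only a factor 2 (`edgeFreeDensity_mul_le`).

Before stage `i` each surviving edge `e` carries a set `G e ⊆ H e` of size `r i`. Once `W` is
exposed, `e` survives if some current `G e' ⊆ W ∪ G e` has at most `r (i + 1)` vertices off `W`;
then `G e` shrinks to an `r (i + 1)`-set containing `G e' \ W`, and covering the new set completes
an old one. The new set still lies in `H e`, so it has positive degree and the spread condition
keeps applying. A double count of the pairs `(W, e)` through `W ∪ G e` shows that few edges die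
(`bmean_card_bad_le`).

If at least half of the edges survive to the last stage, Janson's inequality (`bmean_no_edge_le`)
finishes, its correlation sum being bounded by spreadness. Otherwise the accumulated error term
already exceeds 1. -/

/-- The mean of `f` over the random subset of `S` that keeps each element independently with
probability `p`. -/
def bmean {V : Type*} [DecidableEq V] (p : ℝ) (S : Finset V) (f : Finset V → ℝ) : ℝ :=
  ∑ T ∈ S.powerset, p ^ #T * (1 - p) ^ (#S - #T) * f T

/-! ### Binomial random subsets. -/

section Mean

variable {V : Type*} [DecidableEq V] {p : ℝ} {S : Finset V}

theorem bmean_empty (f : Finset V → ℝ) : bmean p ∅ f = f ∅ := by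
  simp [bmean]

theorem bmean_insert {v : V} (hv : v ∉ S) (f : Finset V → ℝ) :
    bmean p (insert v S) f =
      p * bmean p S (fun T => f (insert v T)) + (1 - p) * bmean p S f := by
  unfold bmean
  rw [sum_powerset_insert hv, add_comm, mul_sum, mul_sum]
  congr 1
  · refine sum_congr rfl fun T hT => ?_
    have hvT : v ∉ T := fun h => hv (mem_powerset.1 hT h)
    rw [card_insert_of_notMem hv, card_insert_of_notMem hvT, Nat.add_sub_add_right, pow_succ]
    ring
  · refine sum_congr rfl fun T hT => ?_
    have := card_le_card (mem_powerset.1 hT)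
    rw [card_insert_of_notMem hv, Nat.sub_add_comm this, pow_succ]
    ring

theorem bmean_add (f g : Finset V → ℝ) :
    bmean p S (fun T => f T + g T) = bmean p S f + bmean p S g := by
  simp [bmean, mul_add, sum_add_distrib]

theorem bmean_sub (f g : Finset V → ℝ) :
    bmean p S (fun T => f T - g T) = bmean p S f - bmean p S g := by
  simp [bmean, mul_sub, sum_sub_distrib]

theorem bmean_const_mul (c : ℝ) (f : Finset V → ℝ) :
    bmean p S (fun T => c * f T) = c * bmean p S f := by
  simp only [bmean, mul_sum]
  exact sum_congr rfl fun _ _ => by ring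

theorem bmean_sum {ι : Type*} (I : Finset ι) (f : ι → Finset V → ℝ) :
    bmean p S (fun T => ∑ i ∈ I, f i T) = ∑ i ∈ I, bmean p S (f i) := by
  simp only [bmean, mul_sum]
  exact sum_comm

theorem bmean_mono (h0 : 0 ≤ p) (h1 : p ≤ 1) {f g : Finset V → ℝ} (h : ∀ T, f T ≤ g T) :
    bmean p S f ≤ bmean p S g :=
  sum_le_sum fun T _ => mul_le_mul_of_nonneg_left (h T)
    (mul_nonneg (pow_nonneg h0 _) (pow_nonneg (sub_nonneg.2 h1) _))

theorem bmean_const (c : ℝ) : bmean p S (fun _ => c) = c := by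
  induction S using Finset.induction_on with
  | empty => exact bmean_empty _
  | insert v S hv ih => rw [bmean_insert hv, ih]; ring

theorem bmean_nonneg (h0 : 0 ≤ p) (h1 : p ≤ 1) {f : Finset V → ℝ} (h : ∀ T, 0 ≤ f T) :
    0 ≤ bmean p S f := by
  simpa [bmean_const] using bmean_mono (S := S) h0 h1 (f := fun _ => 0) h

/-- The union of two independent random subsets is a random subset. -/
theorem bmean_union (a b : ℝ) (f : Finset V → ℝ) :
    bmean a S (fun T => bmean b S fun U => f (T ∪ U)) = bmean (1 - (1 - a) * (1 - b)) S f := by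
  induction S using Finset.induction_on generalizing f with
  | empty => simp [bmean_empty]
  | insert v S hv ih =>
    simp only [bmean_insert hv, union_insert, insert_union, insert_idem, bmean_add,
      bmean_const_mul, ih]
    rw [ih (fun T => f (insert v T))]
    ring

theorem bmean_card : bmean p S (fun T => (#T : ℝ)) = #S * p := by
  induction S using Finset.induction_on with
  | empty => simp [bmean_empty]
  | insert v S hv ih =>
    have : bmean p S (fun T => (#(insert v T) : ℝ)) = bmean p S (fun T => (#T : ℝ) + 1) := by
      refine sum_congr rfl fun T hT => ?_
      simp [card_insert_of_notMem fun h => hv (mem_powerset.1 hT h)]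
    rw [bmean_insert hv, this, bmean_add, bmean_const, ih, card_insert_of_notMem hv]
    push_cast; ring

open Classical in
theorem bmean_indicator_mem {v : V} (hv : v ∈ S) (f : Finset V → ℝ) :
    bmean p S (fun T => if v ∈ T then f T else 0) = p * bmean p S (fun T => f (insert v T)) := by
  obtain ⟨R, hR, rfl⟩ : ∃ R, v ∉ R ∧ insert v R = S :=
    ⟨S.erase v, notMem_erase _ _, insert_erase hv⟩
  have : bmean p R (fun T => if v ∈ T then f T else 0) = bmean p R (fun _ => 0) := by
    refine sum_congr rfl fun T hT => ?_
    simp [if_neg fun h => hR (mem_powerset.1 hT h)]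
  rw [bmean_insert hR, bmean_insert hR, this, bmean_const]
  simp only [mem_insert_self, if_true, insert_idem]
  ring

-- Conditioned on containing `A`, the rest of the set is still random. This trades a sum over the
-- edges inside `W` for planting one edge into `W`.
open Classical in
theorem bmean_indicator_subset {A : Finset V} (hA : A ⊆ S) (f : Finset V → ℝ) :
    bmean p S (fun T => if A ⊆ T then f T else 0) =
      p ^ #A * bmean p S (fun T => f (T ∪ A)) := by
  induction A using Finset.induction_on generalizing f with
  | empty => simp
  | insert v A hv ih =>
    have h1 : (fun T => if insert v A ⊆ T then f T else 0) =
        fun T => if v ∈ T then (if A ⊆ T then f T else 0) else 0 := by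
      funext T
      by_cases h : v ∈ T <;> simp [insert_subset_iff, h]
    have h2 : (fun T => if A ⊆ insert v T then f (insert v T) else 0) =
        fun T => if A ⊆ T then f (insert v T) else 0 := by
      funext T
      simp only [subset_insert_iff_of_notMem hv]
    rw [h1, bmean_indicator_mem (hA (mem_insert_self _ _)), h2,
      ih ((subset_insert _ _).trans hA) (fun T => f (insert v T)), card_insert_of_notMem hv, pow_succ]
    simp only [union_insert]
    ring

open Classical in
theorem bmean_subset_union {A : Finset V} (hA : A ⊆ S) (B : Finset V) :
    bmean p S (fun T => if A ⊆ T ∪ B then 1 else 0) = p ^ #(A \ B) := by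
  have h : ∀ T, (A ⊆ T ∪ B) = (A \ B ⊆ T) := fun T => by
    rw [union_comm]
    exact propext sdiff_le_iff.symm
  simp only [h]
  rw [bmean_indicator_subset (sdiff_subset.trans hA) (fun _ => 1), bmean_const, mul_one]

end Mean

/-! ### Positive correlation of decreasing functions. -/

section FKG

variable {V : Type*} [DecidableEq V] [Fintype V] {p : ℝ}

theorem bmean_univ (f : Finset V → ℝ) :
    bmean p univ f = ∑ T : Finset V, p ^ #T * (1 - p) ^ (Fintype.card V - #T) * f T := by
  simp [bmean]

/-- The FKG inequality for the increasing nonnegative functions `1 - f` and `1 - g`; a product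
measure satisfies the lattice condition with equality. -/
theorem bmean_mul_le_of_antitone (h0 : 0 ≤ p) (h1 : p ≤ 1) {f g : Finset V → ℝ}
    (hf : Antitone f) (hg : Antitone g) (hf1 : ∀ T, f T ≤ 1) (hg1 : ∀ T, g T ≤ 1) :
    bmean p univ f * bmean p univ g ≤ bmean p univ (fun T => f T * g T) := by
  have h := fkg (fun T => 1 - f T) (fun T => 1 - g T)
    (fun T : Finset V => p ^ #T * (1 - p) ^ (Fintype.card V - #T))
    (fun T => mul_nonneg (pow_nonneg h0 _) (pow_nonneg (sub_nonneg.2 h1) _))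
    (fun T => sub_nonneg.2 (hf1 T)) (fun T => sub_nonneg.2 (hg1 T))
    (fun _ _ hab => sub_le_sub_left (hf hab) _) (fun _ _ hab => sub_le_sub_left (hg hab) _) ?_
  · have e1 : ∑ T : Finset V, p ^ #T * (1 - p) ^ (Fintype.card V - #T) = 1 := by
      simpa [bmean_univ] using bmean_const (p := p) (S := (univ : Finset V)) 1
    have e2 : (fun T => (1 - f T) * (1 - g T)) = fun T => (1 - f T - g T) + f T * g T := by
      funext T; ring
    rw [e1, one_mul] at h
    simp only [← bmean_univ] at h
    rw [e2, bmean_add, bmean_sub (fun T => 1 - f T), bmean_sub, bmean_sub, bmean_const] at h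
    nlinarith [h]
  · intro a b
    have hc := card_union_add_card_inter a b
    have ha := card_le_univ a
    have hb := card_le_univ b
    have hu := card_le_univ (a ∪ b)
    have hi := card_le_univ (a ∩ b)
    refine le_of_eq ?_
    simp only [inf_eq_inter, sup_eq_union]
    have : ∀ i j k l : ℕ, p ^ i * (1 - p) ^ j * (p ^ k * (1 - p) ^ l) =
      p ^ (i + k) * (1 - p) ^ (j + l) := fun i j k l => by ring
    rw [this, this]
    congr 2 <;> omega

end FKG

/-! ### One shrinking stage, and Janson's inequality. -/

section Stage

variable {V E : Type*} [DecidableEq V] {p q N x R : ℝ} {F : Finset E} {G : E → Finset V}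
  {A : Finset V} {k r : ℕ}

theorem sum_pow_card_inter_le (hp : 0 < p) (hq : 0 < q) (hx : q / p ≤ 1 / 2)
    (hN : 0 ≤ N) (hM : ∀ j, k ≤ j → (#{e ∈ F | j ≤ #(A ∩ G e)} : ℝ) ≤ q ^ j * N) :
    ∑ e ∈ F with k ≤ #(A ∩ G e), (1 / p) ^ #(A ∩ G e) ≤ N * (2 * (q / p) ^ k) := by
  have hx0 : 0 < q / p := div_pos hq hp
  have hmaps : ∀ e ∈ F.filter (fun e => k ≤ #(A ∩ G e)), #(A ∩ G e) ∈ Ico k (#A + 1) :=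
    fun e he => mem_Ico.2 ⟨(mem_filter.1 he).2,
      Nat.lt_succ_of_le (card_le_card inter_subset_left)⟩
  rw [← sum_fiberwise_of_maps_to hmaps]
  calc _ ≤ ∑ j ∈ Ico k (#A + 1), N * (q / p) ^ j := by
        refine sum_le_sum fun j hj => ?_
        have h1 : ∑ e ∈ F.filter (fun e => k ≤ #(A ∩ G e)) with #(A ∩ G e) = j,
            (1 / p) ^ #(A ∩ G e) =
            #{e ∈ F.filter (fun e => k ≤ #(A ∩ G e)) | #(A ∩ G e) = j} * (1 / p) ^ j := by
          rw [← nsmul_eq_mul]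
          exact sum_eq_card_nsmul fun e he => by rw [(mem_filter.1 he).2]
        have h2 : (#{e ∈ F.filter (fun e => k ≤ #(A ∩ G e)) | #(A ∩ G e) = j} : ℝ) ≤
            q ^ j * N := by
          refine le_trans (Nat.cast_le.2 (card_le_card fun e he => ?_)) (hM j (mem_Ico.1 hj).1)
          simp only [mem_filter] at he ⊢
          exact ⟨he.1.1, he.2.ge⟩
        rw [h1]
        calc _ ≤ q ^ j * N * (1 / p) ^ j := by gcongr
          _ = _ := by rw [div_pow, div_pow, one_pow]; ring
    _ = N * ∑ j ∈ Ico k (#A + 1), (q / p) ^ j := by rw [mul_sum]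
    _ ≤ _ := by
        refine mul_le_mul_of_nonneg_left ?_ hN
        refine (geom_sum_Ico_le_of_lt_one hx0.le (by linarith)).trans ?_
        rw [div_le_iff₀ (by linarith)]
        nlinarith [pow_pos hx0 k]

theorem pow_card_sdiff_eq (hp : 0 < p) {B : Finset V} (hB : #B = r) :
    p ^ #(B \ A) = p ^ r * (1 / p) ^ #(A ∩ B) := by
  have h : #(B \ A) + #(A ∩ B) = r := by
    rw [inter_comm, card_sdiff_add_card_inter, hB]
  rw [← h, pow_add, mul_assoc, ← mul_pow, mul_one_div_cancel hp.ne', one_pow, mul_one]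

open Classical in
/-- The edges `e` of `F` such that no edge inside `W ∪ G e` has at most `k` vertices off `W`. -/
noncomputable def badEdges (F : Finset E) (G : E → Finset V) (k : ℕ) (W : Finset V) : Finset E :=
  {e ∈ F | ∀ e' ∈ F, G e' ⊆ W ∪ G e → k < #(G e' \ W)}

theorem mem_badEdges {W : Finset V} {e : E} :
    e ∈ badEdges F G k W ↔ e ∈ F ∧ ∀ e' ∈ F, G e' ⊆ W ∪ G e → k < #(G e' \ W) := by
  simp [badEdges]

open Classical in
/-- The indicator that `W` contains no edge of `F`. -/
noncomputable def missIndicator (F : Finset E) (G : E → Finset V) (W : Finset V) : ℝ :=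
  if ∀ e ∈ F, ¬ G e ⊆ W then 1 else 0

theorem missIndicator_nonneg (F : Finset E) (G : E → Finset V) (W : Finset V) :
    0 ≤ missIndicator F G W := by
  unfold missIndicator; split_ifs <;> norm_num

theorem missIndicator_le_one (F : Finset E) (G : E → Finset V) (W : Finset V) :
    missIndicator F G W ≤ 1 := by
  unfold missIndicator; split_ifs <;> norm_num

variable [Fintype V]

-- Put `Z = W ∪ G e`. Pairs `(W, e)` for which `Z` contains at most `T = θ * N * p ^ r` edges are
-- rare by counting them from `Z`. For the other bad pairs, more than `T` edges inside `Z` all meet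
-- `G e` in at least `k` vertices, which Markov's inequality makes rare.
open Classical in
theorem bmean_card_bad_le {θ : ℝ} (hp : 0 < p) (hp1 : p ≤ 1) (hq : 0 < q) (hx : q / p ≤ 1 / 2)
    (hθ : 0 < θ) (hN : 0 < N) (hFN : (#F : ℝ) ≤ N) (hG : ∀ e ∈ F, #(G e) = r)
    (hM : ∀ e ∈ F, ∀ j, k ≤ j → (#{e' ∈ F | j ≤ #(G e ∩ G e')} : ℝ) ≤ q ^ j * N) :
    bmean p univ
      (fun W => (#(badEdges F G k W) : ℝ)) ≤
      N * (θ + 2 * (q / p) ^ k / θ) := by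
  set T : ℝ := θ * N * p ^ r with hT
  have hpr : 0 < p ^ r := pow_pos hp r
  have hT0 : 0 < T := by positivity
  set X : Finset V → ℝ := fun Z => ∑ e' ∈ F, if G e' ⊆ Z then 1 else 0 with hX
  set Y : E → Finset V → ℝ := fun e Z =>
    ∑ e' ∈ F with k ≤ #(G e ∩ G e'), if G e' ⊆ Z then 1 else 0 with hY
  have hY0 : ∀ e Z, 0 ≤ Y e Z := fun e Z => sum_nonneg fun _ _ => by split_ifs <;> norm_num
  set g : Finset V → ℝ := fun Z => if X Z ≤ T then 1 else 0 with hg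
  have key : ∀ W, (#(badEdges F G k W) : ℝ) ≤
      ∑ e ∈ F, (g (W ∪ G e) + T⁻¹ * Y e (W ∪ G e)) := by
    intro W
    rw [badEdges, card_filter, Nat.cast_sum]
    refine sum_le_sum fun e _ => ?_
    have hg0 : 0 ≤ g (W ∪ G e) := by simp only [hg]; split_ifs <;> norm_num
    have hYT : 0 ≤ T⁻¹ * Y e (W ∪ G e) := mul_nonneg (inv_pos.2 hT0).le (hY0 _ _)
    split_ifs with hbad
    -- For bad `e`, an edge inside `W ∪ G e` has more than `k` vertices off `W`, and these all lie
    -- in `G e`.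
    · have hXY : X (W ∪ G e) = Y e (W ∪ G e) := by
        simp only [hX, hY]
        rw [sum_filter]
        refine sum_congr rfl fun e' he' => ?_
        by_cases hs : G e' ⊆ W ∪ G e
        · have h1 : G e' \ W ⊆ G e ∩ G e' := by
            intro v hv
            rw [mem_sdiff] at hv
            have := hs hv.1
            simp only [mem_union, mem_inter] at this ⊢
            tauto
          rw [if_pos ((hbad e' he' hs).le.trans (card_le_card h1))]
        · simp [hs]
      by_cases hc : X (W ∪ G e) ≤ T
      · have : g (W ∪ G e) = 1 := if_pos hc
        push_cast; linarith
      · have : 1 ≤ T⁻¹ * Y e (W ∪ G e) := by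
          rw [← hXY, inv_mul_eq_div, one_le_div hT0]; exact (not_le.1 hc).le
        push_cast; linarith
    · push_cast; linarith
  have hA : ∑ e ∈ F, bmean p univ (fun W => g (W ∪ G e)) ≤ θ * N := by
    -- Each `Z` with `X Z ≤ T` arises from at most `T` planted edges.
    have h1 : p ^ r * ∑ e ∈ F, bmean p univ (fun W => g (W ∪ G e)) ≤ T := by
      have : p ^ r * ∑ e ∈ F, bmean p univ (fun W => g (W ∪ G e)) =
          bmean p univ (fun W => ∑ e ∈ F, if G e ⊆ W then g W else 0) := by
        rw [bmean_sum, mul_sum]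
        refine sum_congr rfl fun e he => ?_
        rw [bmean_indicator_subset (subset_univ _), hG e he]
      rw [this, ← bmean_const (p := p) (S := (univ : Finset V)) T]
      refine bmean_mono hp.le hp1 fun W => ?_
      have : (∑ e ∈ F, if G e ⊆ W then g W else 0) = X W * g W := by
        simp only [hX, sum_mul, ite_mul, one_mul, zero_mul]
      rw [this]
      simp only [hg]
      split_ifs with h
      · simpa using h
      · simpa using hT0.le
    have h2 : T = p ^ r * (θ * N) := by rw [hT]; ring
    rw [h2] at h1
    exact le_of_mul_le_mul_left h1 hpr
  have hB : ∀ e ∈ F, bmean p univ (fun W => Y e (W ∪ G e)) ≤ p ^ r * (N * (2 * (q / p) ^ k)) := by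
    intro e he
    simp only [hY]
    rw [bmean_sum]
    refine le_trans (le_of_eq ?_) (mul_le_mul_of_nonneg_left
      (sum_pow_card_inter_le hp hq hx hN.le (hM e he)) hpr.le)
    rw [mul_sum]
    refine sum_congr rfl fun e' he' => ?_
    rw [bmean_subset_union (subset_univ _), pow_card_sdiff_eq hp (hG e' (mem_filter.1 he').1)]
  calc _ ≤ _ := bmean_mono hp.le hp1 key
    _ = ∑ e ∈ F, bmean p univ (fun W => g (W ∪ G e)) +
        ∑ e ∈ F, T⁻¹ * bmean p univ (fun W => Y e (W ∪ G e)) := by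
      rw [bmean_sum, ← sum_add_distrib]
      refine sum_congr rfl fun e _ => ?_
      rw [bmean_add, bmean_const_mul]
    _ ≤ θ * N + ∑ e ∈ F, T⁻¹ * (p ^ r * (N * (2 * (q / p) ^ k))) := by
      refine add_le_add hA (sum_le_sum fun e he => ?_)
      exact mul_le_mul_of_nonneg_left (hB e he) (inv_pos.2 hT0).le
    _ ≤ θ * N + N * (T⁻¹ * (p ^ r * (N * (2 * (q / p) ^ k)))) := by
      rw [sum_const, nsmul_eq_mul]
      gcongr
    _ = _ := by
      rw [hT]; field_simp

open Classical in
/-- Janson's inequality. -/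
theorem bmean_no_edge_le (hp : 0 < p) (hp1 : p ≤ 1) (hF : F.Nonempty) (hR : 0 < R)
    (hG : ∀ e ∈ F, #(G e) = r)
    (hD : ∀ e ∈ F, ∑ e' ∈ F with 1 ≤ #(G e ∩ G e'), (1 / p) ^ #(G e ∩ G e') ≤ #F * R) :
    bmean p univ (missIndicator F G) ≤ Real.exp (-(1 / R)) := by
  have hpr : 0 < p ^ r := pow_pos hp r
  set μ : ℝ := #F * p ^ r with hμ
  have hμ0 : 0 < μ := mul_pos (Nat.cast_pos.2 hF.card_pos) hpr
  set I : E → Finset V → ℝ := fun e Z => if G e ⊆ Z then 1 else 0 with hI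
  have hI0 : ∀ e Z, 0 ≤ I e Z := fun e Z => by simp only [hI]; split_ifs <;> norm_num
  have hImono : ∀ e, Monotone (I e) := by
    intro e Z Z' h
    simp only [hI]
    split_ifs with h1 h2 h2
    · exact le_rfl
    · exact absurd (h1.trans h) h2
    · norm_num
    · exact le_rfl
  set X : Finset V → ℝ := fun Z => ∑ e ∈ F, I e Z with hX
  set Y : E → Finset V → ℝ := fun e Z => ∑ e' ∈ F with 1 ≤ #(G e ∩ G e'), I e' Z with hY
  set Z' : E → Finset V → ℝ := fun e Z => ∑ e' ∈ F with ¬ 1 ≤ #(G e ∩ G e'), I e' Z with hZ'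
  have hXYZ : ∀ e Z, X Z = Y e Z + Z' e Z := fun e Z =>
    (sum_filter_add_sum_filter_not F (fun e' => 1 ≤ #(G e ∩ G e')) (fun e' => I e' Z)).symm
  have hZ'eq : ∀ e W, Z' e (W ∪ G e) = Z' e W := by
    intro e W
    refine sum_congr rfl fun e' he' => ?_
    have hd : Disjoint (G e') (G e) := by
      have := (mem_filter.1 he').2
      rw [disjoint_iff_inter_eq_empty, inter_comm, ← card_eq_zero]
      omega
    have : G e' ⊆ W ∪ G e ↔ G e' ⊆ W :=
      ⟨fun h => hd.left_le_of_le_sup_right h, fun h => h.trans subset_union_left⟩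
    simp only [hI, this]
  have hYmono : ∀ e, Monotone (Y e) := fun e _ _ h => sum_le_sum fun e' _ => hImono e' h
  have hZmono : ∀ e, Monotone (Z' e) := fun e _ _ h => sum_le_sum fun e' _ => hImono e' h
  have hY0 : ∀ e W, 0 ≤ Y e W := fun e W => sum_nonneg fun _ _ => hI0 _ _
  have hZ0 : ∀ e W, 0 ≤ Z' e W := fun e W => sum_nonneg fun _ _ => hI0 _ _
  have hYmean : ∀ e ∈ F, bmean p univ (fun W => Y e (W ∪ G e)) ≤ μ * R := by
    intro e he
    simp only [hY, hI]
    rw [bmean_sum]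
    have h1 := mul_le_mul_of_nonneg_left (hD e he) hpr.le
    refine le_trans (le_of_eq ?_) (h1.trans (le_of_eq (by rw [hμ]; ring)))
    rw [mul_sum]
    refine sum_congr rfl fun e' he' => ?_
    rw [bmean_subset_union (subset_univ _), pow_card_sdiff_eq hp (hG e' (mem_filter.1 he').1)]
  set Ψ : ℝ → ℝ := fun s => bmean p univ (fun W => Real.exp (-(s * X W))) with hΨ
  have hΨ0 : ∀ s, 0 ≤ Ψ s := fun s => bmean_nonneg hp.le hp1 fun W => (Real.exp_pos _).le
  have hlow : ∀ s, 0 ≤ s → μ * Real.exp (-(s * (μ * R))) * Ψ s ≤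
      bmean p univ (fun W => X W * Real.exp (-(s * X W))) := by
    intro s hs
    have h1 : bmean p univ (fun W => X W * Real.exp (-(s * X W))) =
        ∑ e ∈ F, p ^ r * bmean p univ (fun W => Real.exp (-(s * X (W ∪ G e)))) := by
      have : ∀ W, X W * Real.exp (-(s * X W)) =
          ∑ e ∈ F, if G e ⊆ W then Real.exp (-(s * X W)) else 0 := fun W => by
        simp only [hX, hI, sum_mul, ite_mul, one_mul, zero_mul]
      simp only [this]
      rw [bmean_sum]
      refine sum_congr rfl fun e he => ?_
      rw [bmean_indicator_subset (subset_univ _) (fun W => Real.exp (-(s * X W))), hG e he]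
    have h2 : ∀ e ∈ F, p ^ r * (Real.exp (-(s * (μ * R))) * Ψ s) ≤
        p ^ r * bmean p univ (fun W => Real.exp (-(s * X (W ∪ G e)))) := by
      intro e he
      refine mul_le_mul_of_nonneg_left ?_ hpr.le
      have hfac : ∀ W, Real.exp (-(s * X (W ∪ G e))) =
          Real.exp (-(s * Y e (W ∪ G e))) * Real.exp (-(s * Z' e W)) := fun W => by
        rw [← Real.exp_add, hXYZ e, hZ'eq]; ring_nf
      simp only [hfac]
      have hfkg := bmean_mul_le_of_antitone (p := p) hp.le hp1
        (f := fun W => Real.exp (-(s * Y e (W ∪ G e)))) (g := fun W => Real.exp (-(s * Z' e W)))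
        (fun W W' h => Real.exp_le_exp.2 (neg_le_neg (mul_le_mul_of_nonneg_left
          (hYmono e (union_subset_union_left h)) hs)))
        (fun W W' h => Real.exp_le_exp.2 (neg_le_neg (mul_le_mul_of_nonneg_left
          (hZmono e h) hs)))
        (fun W => Real.exp_le_one_iff.2 (neg_nonpos.2 (mul_nonneg hs (hY0 _ _))))
        (fun W => Real.exp_le_one_iff.2 (neg_nonpos.2 (mul_nonneg hs (hZ0 _ _))))
      refine le_trans (mul_le_mul ?_ ?_ (hΨ0 s) ?_) hfkg
      · set c := s * (μ * R) with hc
        -- The tangent line of the exponential at `c`, an upper bound for the mean of `s * Y e`,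
        -- stands in for Jensen's inequality.
        have hpt : ∀ W, Real.exp (-c) * ((1 + c) - s * Y e (W ∪ G e)) ≤
            Real.exp (-(s * Y e (W ∪ G e))) := fun W => by
          have : Real.exp (-(s * Y e (W ∪ G e))) =
              Real.exp (-c) * Real.exp (c - s * Y e (W ∪ G e)) := by
            rw [← Real.exp_add]; ring_nf
          rw [this]
          refine mul_le_mul_of_nonneg_left ?_ (Real.exp_pos _).le
          linarith [Real.add_one_le_exp (c - s * Y e (W ∪ G e))]
        refine le_trans ?_ (bmean_mono hp.le hp1 hpt)
        rw [bmean_const_mul, bmean_sub, bmean_const, bmean_const_mul]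
        have := mul_le_mul_of_nonneg_left (hYmean e he) hs
        nlinarith [Real.exp_pos (-c)]
      · refine bmean_mono hp.le hp1 fun W => Real.exp_le_exp.2 (neg_le_neg ?_)
        exact mul_le_mul_of_nonneg_left (by rw [hXYZ e]; linarith [hY0 e W]) hs
      · exact bmean_nonneg hp.le hp1 fun W => (Real.exp_pos _).le
    rw [h1]
    refine le_trans (le_of_eq ?_) (sum_le_sum h2)
    rw [sum_const, nsmul_eq_mul, hμ]; ring
  have hderiv : ∀ s, HasDerivAt Ψ (-bmean p univ (fun W => X W * Real.exp (-(s * X W)))) s := by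
    intro s
    simp only [hΨ, bmean]
    rw [← sum_neg_distrib]
    refine HasDerivAt.fun_sum fun W _ => ?_
    have : HasDerivAt (fun s : ℝ => Real.exp (-(s * X W)))
        (Real.exp (-(s * X W)) * -(1 * X W)) s :=
      (((hasDerivAt_id s).mul_const (X W)).neg).exp
    exact (this.const_mul (p ^ #W * (1 - p) ^ (#univ - #W))).congr_deriv (by ring)
  -- `hlow` says `(log Ψ)' ≤ -μ * exp (-(s * μ * R))`. Integrating gives this decreasing quantity,
  -- free of logarithms; `s → ∞` then yields the bound.
  set Φ : ℝ → ℝ := fun s => Ψ s * Real.exp (-(1 / R * Real.exp (-(s * (μ * R))))) with hΦ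
  have hΦderiv : ∀ s, HasDerivAt Φ
      (-bmean p univ (fun W => X W * Real.exp (-(s * X W))) *
          Real.exp (-(1 / R * Real.exp (-(s * (μ * R))))) +
        Ψ s * (Real.exp (-(1 / R * Real.exp (-(s * (μ * R))))) *
          -(1 / R * (Real.exp (-(s * (μ * R))) * -(1 * (μ * R)))))) s := fun s =>
    (hderiv s).mul ((((((hasDerivAt_id s).mul_const (μ * R)).neg).exp).const_mul (1 / R)).neg).exp
  have hanti : AntitoneOn Φ (Set.Ici 0) := by
    refine antitoneOn_of_deriv_nonpos (convex_Ici 0)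
      (fun s _ => (hΦderiv s).continuousAt.continuousWithinAt)
      (fun s _ => (hΦderiv s).differentiableAt.differentiableWithinAt) fun s hs => ?_
    rw [interior_Ici] at hs
    rw [(hΦderiv s).deriv]
    have h1 := hlow s (le_of_lt hs)
    have h2 : 1 / R * (Real.exp (-(s * (μ * R))) * -(1 * (μ * R))) =
        -(μ * Real.exp (-(s * (μ * R)))) := by field_simp
    rw [h2]
    nlinarith [Real.exp_pos (-(1 / R * Real.exp (-(s * (μ * R)))))]
  have hbound : ∀ s, 0 ≤ s →
      bmean p univ (missIndicator F G) ≤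
        Real.exp (-(1 / R)) * Real.exp (1 / R * Real.exp (-(s * (μ * R)))) := by
    intro s hs
    have h0 : Φ s ≤ Φ 0 := hanti (Set.mem_Ici.2 le_rfl) (Set.mem_Ici.2 hs) hs
    have h1 : Φ 0 = Real.exp (-(1 / R)) := by
      simp [hΦ, hΨ, bmean_const]
    have h2 : Ψ s ≤ Real.exp (-(1 / R)) * Real.exp (1 / R * Real.exp (-(s * (μ * R)))) := by
      rw [h1] at h0
      simp only [hΦ, Real.exp_neg (1 / R * _)] at h0
      rwa [← div_eq_mul_inv, div_le_iff₀ (Real.exp_pos _)] at h0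
    refine le_trans (bmean_mono hp.le hp1 fun W => ?_) h2
    unfold missIndicator
    split_ifs with h
    · have : X W = 0 := sum_eq_zero fun e he => if_neg (h e he)
      simp [this]
    · exact (Real.exp_pos _).le
  have hlim : Filter.Tendsto
      (fun s : ℝ => Real.exp (-(1 / R)) * Real.exp (1 / R * Real.exp (-(s * (μ * R)))))
      Filter.atTop (nhds (Real.exp (-(1 / R)) * Real.exp (1 / R * 0))) := by
    refine Filter.Tendsto.const_mul _ ((Real.continuous_exp.tendsto _).comp ?_)
    refine Filter.Tendsto.const_mul _ ?_
    exact Real.tendsto_exp_neg_atTop_nhds_zero.comp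
      (Filter.tendsto_id.atTop_mul_const (mul_pos hμ0 hR))
  rw [mul_zero, Real.exp_zero, mul_one] at hlim
  exact ge_of_tendsto hlim (Filter.eventually_atTop.2 ⟨0, hbound⟩)

end Stage

/-! ### From binomial sets to sets of fixed size. -/

section Transfer

variable {V E : Type*} [DecidableEq V] [Fintype V] [Fintype E] (H : E → Finset V)

open Classical in
/-- The `k`-element vertex sets that contain no edge. -/
def edgeFree (k : ℕ) : Finset (Finset V) :=
  ((univ : Finset V).powersetCard k).filter fun W => ∀ e, ¬ H e ⊆ W

/-- The proportion of edge-free sets among the `k`-element vertex sets. -/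
noncomputable def edgeFreeDensity (k : ℕ) : ℝ :=
  #(edgeFree H k) / (Fintype.card V).choose k

theorem edgeFreeDensity_nonneg (k : ℕ) : 0 ≤ edgeFreeDensity H k := by
  unfold edgeFreeDensity; positivity

/-- Removing a vertex keeps a set edge-free, so the shadow of one level lies in the level below and
local LYM compares the densities. Levels above `|V|` have density 0 since division by zero gives 0.
-/
theorem edgeFreeDensity_antitone : Antitone (edgeFreeDensity H) := by
  refine antitone_nat_of_succ_le fun k => ?_
  have hs : ((edgeFree H (k + 1) : Finset (Finset V)) : Set (Finset V)).Sized (k + 1) := by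
    intro W hW
    exact (mem_powersetCard_univ.1 (mem_filter.1 hW).1)
  have h := local_lubell_yamamoto_meshalkin_inequality_div (𝕜 := ℝ) (Nat.succ_ne_zero k) hs
  refine h.trans ?_
  rw [Nat.succ_sub_one]
  unfold edgeFreeDensity
  gcongr
  intro W hW
  obtain ⟨W', hW', v, hv, rfl⟩ := mem_shadow_iff.1 hW
  refine mem_filter.2 ⟨mem_powersetCard_univ.2 ?_, fun e he =>
    (mem_filter.1 hW').2 e (he.trans (erase_subset _ _))⟩
  rw [card_erase_of_mem hv, hs hW', Nat.add_sub_cancel]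

theorem one_sub_probContainsEdge {m : ℕ} (hm : m ≤ Fintype.card V) :
    1 - probContainsEdge H m = edgeFreeDensity H m := by
  have hc : (0 : ℝ) < (Fintype.card V).choose m := Nat.cast_pos.2 (Nat.choose_pos hm)
  have hsum := card_filter_add_card_filter_not (s := (univ : Finset V).powersetCard m)
    (fun W => ∃ e, H e ⊆ W)
  have hE : edgeFree H m = ((univ : Finset V).powersetCard m).filter (fun W => ¬ ∃ e, H e ⊆ W) := by
    ext W; simp [edgeFree]
  rw [card_powersetCard, card_univ] at hsum
  unfold probContainsEdge edgeFreeDensity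
  rw [hE, card_powersetCard, card_univ, eq_div_iff hc.ne', sub_mul, div_mul_cancel₀ _ hc.ne']
  have : ((Fintype.card V).choose m : ℝ) = _ := congrArg (Nat.cast (R := ℝ)) hsum.symm
  push_cast at this
  linarith

-- Sets of size at most `m` are at least as likely to be edge-free as those of size `m`. Markov's
-- inequality for the size enters through `1 - #W / (m + 1)`, which is at most the indicator of `#W
-- ≤ m`.
open Classical in
theorem edgeFreeDensity_mul_le {p : ℝ} (hp : 0 ≤ p) (hp1 : p ≤ 1) (m : ℕ) :
    edgeFreeDensity H m * (1 - Fintype.card V * p / (m + 1)) ≤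
      bmean p univ (missIndicator univ H) := by
  have h1 : edgeFreeDensity H m * (1 - Fintype.card V * p / (m + 1)) =
      bmean p (univ : Finset V) (fun W => edgeFreeDensity H m * (1 - (1 / (m + 1)) * #W)) := by
    rw [bmean_const_mul, bmean_sub, bmean_const, bmean_const_mul, bmean_card, card_univ]
    ring
  rw [h1]
  unfold bmean
  rw [sum_powerset, sum_powerset]
  refine sum_le_sum fun k hk => ?_
  have hk' : k ≤ Fintype.card V := Nat.lt_succ_iff.1 (by simpa using hk)
  have hc : (0 : ℝ) < (Fintype.card V).choose k := Nat.cast_pos.2 (Nat.choose_pos hk')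
  set w : ℝ := p ^ k * (1 - p) ^ (#(univ : Finset V) - k) with hw
  have hw0 : 0 ≤ w := mul_nonneg (pow_nonneg hp _) (pow_nonneg (sub_nonneg.2 hp1) _)
  have e1 : ∑ W ∈ powersetCard k (univ : Finset V), p ^ #W * (1 - p) ^ (#(univ : Finset V) - #W) *
      (edgeFreeDensity H m * (1 - (1 / ((m : ℝ) + 1)) * #W)) =
      (Fintype.card V).choose k *
        (w * (edgeFreeDensity H m * (1 - (1 / ((m : ℝ) + 1)) * k))) := by
    have : (Fintype.card V).choose k = #(powersetCard k (univ : Finset V)) := by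
      rw [card_powersetCard, card_univ]
    rw [this, ← nsmul_eq_mul]
    refine sum_eq_card_nsmul fun W hW => ?_
    rw [mem_powersetCard_univ.1 hW]
  have e2 : ∑ W ∈ powersetCard k (univ : Finset V), p ^ #W * (1 - p) ^ (#(univ : Finset V) - #W) *
      missIndicator univ H W =
      (Fintype.card V).choose k * (w * edgeFreeDensity H k) := by
    have h3 : (Fintype.card V).choose k * (w * edgeFreeDensity H k) = #(edgeFree H k) * w := by
      unfold edgeFreeDensity; field_simp
    rw [h3, edgeFree, card_filter]
    push_cast
    rw [sum_mul]
    refine sum_congr rfl fun W hW => ?_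
    rw [mem_powersetCard_univ.1 hW, mul_comm]
    simp [missIndicator, hw]
  rw [e1, e2]
  refine mul_le_mul_of_nonneg_left (mul_le_mul_of_nonneg_left ?_ hw0) hc.le
  have hm1 : (0 : ℝ) < m + 1 := by positivity
  rcases Nat.lt_or_ge m k with h | h
  · have h2 : (m : ℝ) + 1 ≤ k := by exact_mod_cast h
    have : 1 ≤ 1 / ((m : ℝ) + 1) * k := by
      rw [one_div, inv_mul_eq_div, one_le_div hm1]; exact h2
    nlinarith [edgeFreeDensity_nonneg H k, edgeFreeDensity_nonneg H m]
  · have : 0 ≤ 1 / ((m : ℝ) + 1) * k := by positivity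
    have h2 := edgeFreeDensity_antitone H h
    nlinarith [edgeFreeDensity_nonneg H m]

theorem probContainsEdge_card [Nonempty E] : probContainsEdge H (Fintype.card V) = 1 := by
  unfold probContainsEdge
  rw [← card_univ, powersetCard_self, filter_true_of_mem]
  · simp
  · intro W hW
    exact ⟨Classical.arbitrary E, by rw [mem_singleton.1 hW]; exact subset_univ _⟩

end Transfer

/-! ### Iterating the stages. -/

section Iteration

/-- The density of the union of `k` independent random sets of density `a` and one of density `b`. -/
def unionDensity (a b : ℝ) : ℕ → ℝ
  | 0 => b
  | k + 1 => 1 - (1 - a) * (1 - unionDensity a b k)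

theorem unionDensity_mem {a b : ℝ} (ha : 0 ≤ a) (ha1 : a ≤ 1) (hb : 0 ≤ b) (hb1 : b ≤ 1) (k : ℕ) :
    0 ≤ unionDensity a b k ∧ unionDensity a b k ≤ 1 ∧ unionDensity a b k ≤ k * a + b := by
  induction k with
  | zero => simp [unionDensity, hb, hb1]
  | succ k ih =>
    obtain ⟨h0, h1, h2⟩ := ih
    simp only [unionDensity]
    push_cast
    refine ⟨?_, ?_, ?_⟩ <;> nlinarith [mul_nonneg (sub_nonneg.2 ha1) (sub_nonneg.2 h1)]

variable {V E : Type*} [DecidableEq V] [Fintype V] [Fintype E] {H : E → Finset V} {r : ℕ → ℕ}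

-- Induction on the number of remaining stages. Each lost edge is charged `2 / |H|`, so losing half
-- of the edges makes the bound trivial.
open Classical in
theorem bmean_unionDensity_le {a b δ β : ℝ} {t : ℕ} [Nonempty E]
    (ha : 0 ≤ a) (ha1 : a ≤ 1) (hb : 0 ≤ b) (hb1 : b ≤ 1) (hδ : 0 ≤ δ)
    (hr : ∀ i, 1 ≤ i → i < t → r (i + 1) ≤ r i)
    (hstage : ∀ i, 1 ≤ i → i < t → ∀ (F : Finset E) (G : E → Finset V),
      (∀ e ∈ F, G e ⊆ H e ∧ #(G e) = r i) →
      bmean a univ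
        (fun W => (#(badEdges F G (r (i + 1)) W) : ℝ)) ≤
        Fintype.card E * β)
    (hfinal : ∀ (F : Finset E) (G : E → Finset V), (∀ e ∈ F, G e ⊆ H e ∧ #(G e) = r t) →
      (Fintype.card E : ℝ) ≤ 2 * #F →
      bmean b univ (missIndicator F G) ≤ δ)
    (k i : ℕ) (hik : i + k = t) (hi : 1 ≤ i) (F : Finset E) (G : E → Finset V)
    (hFG : ∀ e ∈ F, G e ⊆ H e ∧ #(G e) = r i) :
    bmean (unionDensity a b k) univ (missIndicator F G) ≤
      δ + 2 * (Fintype.card E - #F) / Fintype.card E + 2 * k * β := by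
  have hN : (0 : ℝ) < Fintype.card E := Nat.cast_pos.2 Fintype.card_pos
  induction k generalizing i F G with
  | zero =>
    obtain rfl : i = t := by omega
    have hF : (#F : ℝ) ≤ Fintype.card E := Nat.cast_le.2 (card_le_univ F)
    simp only [unionDensity, Nat.cast_zero, mul_zero, zero_mul, add_zero]
    rcases le_total (Fintype.card E : ℝ) (2 * #F) with h | h
    · have : 0 ≤ 2 * ((Fintype.card E : ℝ) - #F) / Fintype.card E :=
        div_nonneg (by linarith) hN.le
      linarith [hfinal F G hFG h]
    · have h1 : 1 ≤ 2 * ((Fintype.card E : ℝ) - #F) / Fintype.card E := by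
        rw [one_le_div hN]; linarith
      have h2 : bmean b univ (missIndicator F G) ≤
          bmean b univ (fun _ => 1) :=
        bmean_mono hb hb1 (missIndicator_le_one F G)
      rw [bmean_const] at h2
      linarith
  | succ k ih =>
    set good : Finset V → Finset E := fun W => F \ badEdges F G (r (i + 1)) W with hgood
    have hcard : ∀ W, (#(good W) : ℝ) = #F - #(badEdges F G (r (i + 1)) W) := fun W =>
      cast_card_sdiff fun e he => (mem_badEdges.1 he).1
    -- The implication is inside the existential so that `choose` gives a total function; edges that
    -- are not good receive `∅`.
    have hex : ∀ W e, ∃ A : Finset V, e ∈ good W →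
        A ⊆ G e ∧ #A = r (i + 1) ∧ ∃ e' ∈ F, G e' \ W ⊆ A := by
      intro W e
      by_cases he : e ∈ good W
      · obtain ⟨heF, hne⟩ := mem_sdiff.1 he
        simp only [mem_badEdges, heF, true_and] at hne
        push Not at hne
        obtain ⟨e', he', hsub, hle⟩ := hne
        obtain ⟨A, h1, h2, h3⟩ := exists_subsuperset_card_eq (s := G e' \ W) (t := G e)
          (sdiff_le_iff.2 hsub) hle (by rw [(hFG e heF).2]; exact hr i hi (by omega))
        exact ⟨A, fun _ => ⟨h2, h3, e', he', h1⟩⟩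
      · exact ⟨∅, fun h => absurd h he⟩
    choose G' hG' using hex
    have hstep : ∀ W, bmean (unionDensity a b k) univ
        (fun U => missIndicator F G (W ∪ U)) ≤
        (δ + 2 * (Fintype.card E - #F) / Fintype.card E + 2 * k * β) +
          2 / Fintype.card E * #(badEdges F G (r (i + 1)) W) := by
      intro W
      obtain ⟨h0, h1, -⟩ := unionDensity_mem ha ha1 hb hb1 k
      have := ih (i + 1) (by omega) (by omega) (good W) (G' W) fun e he =>
        ⟨(hG' W e he).1.trans (hFG e (mem_sdiff.1 he).1).1, (hG' W e he).2.1⟩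
      refine (bmean_mono h0 h1 fun U => ?_).trans (this.trans (le_of_eq ?_))
      · by_cases h : ∀ e ∈ F, ¬ G e ⊆ W ∪ U
        · rw [missIndicator, if_pos h, missIndicator, if_pos]
          intro e he hsub
          obtain ⟨-, -, e', he', hA⟩ := hG' W e he
          exact h e' he' (sdiff_le_iff.1 (hA.trans hsub))
        · rw [missIndicator, if_neg h]; exact missIndicator_nonneg _ _ _
      · rw [hcard]; field_simp; ring
    rw [unionDensity, ← bmean_union]
    refine (bmean_mono ha ha1 hstep).trans ?_
    rw [bmean_add, bmean_const, bmean_const_mul]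
    have h1 := mul_le_mul_of_nonneg_left (hstage i hi (by omega) F G hFG)
      (show 0 ≤ 2 / (Fintype.card E : ℝ) by positivity)
    have h2 : 2 / (Fintype.card E : ℝ) * (Fintype.card E * β) = 2 * β := by field_simp
    rw [h2] at h1
    push_cast
    linarith

end Iteration

/-! ### Consequences of spreadness. -/

section Spread

variable {V E : Type*} [DecidableEq V] {H G : E → Finset V} {q p N : ℝ}
  {r : ℕ → ℕ} {ℓ : ℕ} {F : Finset E}

/-- The weight of `e` is one term of the sum of `(1 / p) ^ #B` over nonempty `B ⊆ A ∩ G e`.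
Exchanging sums leaves degrees, and the binomial theorem sums their bounds. -/
theorem sum_pow_card_inter_le_of_card_le {A : Finset V} (hp : 0 < p)
    (hd : ∀ B ⊆ A, B.Nonempty → (#{e ∈ F | B ⊆ G e} : ℝ) ≤ q ^ #B * N) :
    ∑ e ∈ F with 1 ≤ #(A ∩ G e), (1 / p) ^ #(A ∩ G e) ≤ N * ((1 + q / p) ^ #A - 1) := by
  have hp' : 0 ≤ 1 / p := by positivity
  calc _ ≤ ∑ e ∈ F, ∑ B ∈ A.powerset.erase ∅, if B ⊆ G e then (1 / p) ^ #B else 0 := by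
        rw [sum_filter]
        refine sum_le_sum fun e _ => ?_
        have h0 : ∀ B ∈ A.powerset.erase ∅, 0 ≤ if B ⊆ G e then (1 / p) ^ #B else 0 :=
          fun B _ => by split_ifs <;> positivity
        split_ifs with h
        · have hm : A ∩ G e ∈ A.powerset.erase ∅ :=
            mem_erase.2 ⟨(card_pos.1 h).ne_empty, mem_powerset.2 inter_subset_left⟩
          refine le_trans (le_of_eq ?_) (single_le_sum h0 hm)
          rw [if_pos inter_subset_right]
        · exact sum_nonneg h0
    _ = ∑ B ∈ A.powerset.erase ∅, #{e ∈ F | B ⊆ G e} * (1 / p) ^ #B := by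
        rw [sum_comm]
        refine sum_congr rfl fun B _ => ?_
        rw [← sum_filter, sum_const, nsmul_eq_mul]
    _ ≤ ∑ B ∈ A.powerset.erase ∅, N * (q / p) ^ #B := by
        refine sum_le_sum fun B hB => ?_
        obtain ⟨h1, h2⟩ := mem_erase.1 hB
        calc _ ≤ q ^ #B * N * (1 / p) ^ #B :=
              mul_le_mul_of_nonneg_right (hd B (mem_powerset.1 h2) (nonempty_iff_ne_empty.2 h1))
                (pow_nonneg hp' _)
          _ = _ := by rw [div_pow, div_pow, one_pow]; ring
    _ = _ := by
        rw [← mul_sum]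
        have h1 := sum_pow_mul_eq_add_pow (q / p) 1 A
        simp only [one_pow, mul_one] at h1
        have h2 := sum_erase_add A.powerset (fun B => (q / p) ^ #B) (empty_mem_powerset A)
        rw [h1, card_empty, pow_zero, add_comm (q / p)] at h2
        rw [← h2]; ring

variable [Fintype E]

theorem IsSpread.le_of_le {L i j : ℕ} (h : IsSpread H q r L) (hi : 1 ≤ i) (hij : i ≤ j)
    (hj : j ≤ L) : r j ≤ r i := by
  induction j, hij using Nat.le_induction with
  | base => exact le_rfl
  | succ j hij ih => exact (h.r_strictAnti j (hi.trans hij) hj).le.trans (ih (by omega))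

theorem degree_pos_of_subset {A : Finset V} {e : E} (h : A ⊆ H e) : 0 < degree H A :=
  card_pos.2 ⟨e, mem_filter.2 ⟨mem_univ _, h⟩⟩

theorem IsSpread.card_meet_le {L i : ℕ} (h : IsSpread H q r L) (hi : 1 ≤ i) (hiL : i < L)
    (hFG : ∀ e ∈ F, G e ⊆ H e ∧ #(G e) = r i) {e : E} (he : e ∈ F) {j : ℕ} (hj : r (i + 1) ≤ j) :
    (#{e' ∈ F | j ≤ #(G e ∩ G e')} : ℝ) ≤ q ^ j * Fintype.card E := by
  refine le_trans (Nat.cast_le.2 (card_le_card fun e' he' => ?_))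
    (h.meetCount_le (G e) (degree_pos_of_subset (hFG e he).1) i hi hiL (hFG e he).2.le
      ((h.r_strictAnti i hi hiL).le.trans (hFG e he).2.ge) j hj)
  obtain ⟨h1, h2⟩ := mem_filter.1 he'
  exact mem_filter.2 ⟨mem_univ _,
    h2.trans (card_le_card (inter_subset_inter_left (hFG e' h1).1))⟩

/-- An edge containing `B` meets it in `#B` vertices, so the spread condition applies with `A = B`
and `j = #B`, at the index whose size window contains `#B`. -/
theorem IsSpread.degree_le (h : IsSpread H q r (ℓ + 1)) (hℓ : 1 ≤ ℓ) (hr : r (ℓ + 1) = 1)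
    {B : Finset V} (hB : B.Nonempty) (hB1 : #B ≤ r 1) :
    (degree H B : ℝ) ≤ q ^ #B * Fintype.card E := by
  rcases Nat.eq_zero_or_pos (degree H B) with h0 | h0
  · rw [h0, Nat.cast_zero]
    exact mul_nonneg (pow_nonneg h.q_pos.le _) (Nat.cast_nonneg _)
  have hex : ∃ k, 1 ≤ k ∧ r (k + 1) ≤ #B := ⟨ℓ, hℓ, by rw [hr]; exact hB.card_pos⟩
  classical
  obtain ⟨hk1, hk2⟩ := Nat.find_spec hex
  have hkℓ : Nat.find hex ≤ ℓ := Nat.find_min' hex ⟨hℓ, by rw [hr]; exact hB.card_pos⟩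
  have hk3 : #B ≤ r (Nat.find hex) := by
    rcases hk1.eq_or_lt with h1 | h1
    · rw [← h1]; exact hB1
    · have := Nat.find_min hex (Nat.sub_lt hk1 one_pos)
      rw [Nat.sub_add_cancel hk1] at this
      by_contra hlt
      exact this ⟨by omega, by omega⟩
  refine le_trans (Nat.cast_le.2 (card_le_card fun e he => ?_))
    (h.meetCount_le B h0 _ hk1 (Nat.lt_succ_of_le hkℓ) hk3 hk2 _ hk2)
  refine mem_filter.2 ⟨mem_univ _, ?_⟩
  rw [inter_eq_left.2 (mem_filter.1 he).2]

end Spread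

/-! ### Choice of the densities. -/

section Main

variable {V E : Type*} [Fintype V] [DecidableEq V] [Fintype E] {H : E → Finset V} {q C δ : ℝ}
  {r : ℕ → ℕ} {ℓ t m : ℕ}

theorem IsSpread.bmean_card_bad_le (h : IsSpread H q r (ℓ + 1)) (hC : 8 ≤ C)
    (hp1 : C * q / 4 ≤ 1) {i : ℕ} (hi : 1 ≤ i) (hit : i < t) (ht : t ≤ ℓ)
    {F : Finset E} {G : E → Finset V} (hFG : ∀ e ∈ F, G e ⊆ H e ∧ #(G e) = r i) :
    bmean (C * q / 4) univ
      (fun W => (#(badEdges F G (r (i + 1)) W) : ℝ)) ≤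
      Fintype.card E * (3 * (C / 4) ^ (-((r t : ℝ) / 2))) := by
  have hne := h.nonempty
  have hN : (0 : ℝ) < Fintype.card E := Nat.cast_pos.2 Fintype.card_pos
  have hq := h.q_pos
  have hC4 : 0 < C / 4 := by linarith
  have hx : q / (C * q / 4) = (C / 4)⁻¹ := by field_simp
  have hx2 : (C / 4)⁻¹ ≤ 1 / 2 := by
    rw [inv_le_comm₀ hC4 (by norm_num)]; linarith
  -- The square root of `(q / p) ^ r (i + 1)`, which balances the two error terms into `θ + 2 * θ`.
  set θ : ℝ := (C / 4) ^ (-((r (i + 1) : ℝ) / 2)) with hθ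
  have hθ0 : 0 < θ := Real.rpow_pos_of_pos hC4 _
  have hθ2 : (C / 4)⁻¹ ^ r (i + 1) = θ * θ := by
    rw [hθ, ← Real.rpow_add hC4, inv_pow, ← Real.rpow_natCast, ← Real.rpow_neg hC4.le]
    ring_nf
  have key := MultiHypergraph.bmean_card_bad_le (k := r (i + 1)) (θ := θ) (p := C * q / 4)
    (by positivity) hp1 hq (by rw [hx]; exact hx2) hθ0 hN (Nat.cast_le.2 (card_le_univ F))
    (fun e he => (hFG e he).2)
    (fun e he j hj => h.card_meet_le hi (by omega) hFG he hj)
  refine key.trans (mul_le_mul_of_nonneg_left ?_ hN.le)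
  rw [hx, hθ2, mul_div_assoc, mul_div_cancel_right₀ _ hθ0.ne']
  have hle : θ ≤ (C / 4) ^ (-((r t : ℝ) / 2)) := by
    refine Real.rpow_le_rpow_of_exponent_le (by linarith) ?_
    have : (r t : ℝ) ≤ r (i + 1) := Nat.cast_le.2 (h.le_of_le (by omega) hit (by omega))
    linarith
  linarith

theorem IsSpread.one_sub_probContainsEdge_le (h : IsSpread H q r (ℓ + 1))
    (hunif : IsUniform H (r 1)) (hC : 8 ≤ C) (ht1 : 1 ≤ t) (ht : t ≤ ℓ) (hδ : 0 ≤ δ)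
    (hm : m ≤ Fintype.card V) (hq1 : C * ℓ * q ≤ 1 / 2)
    (hmle : 2 * C * ℓ * q * Fintype.card V ≤ m + 1)
    (hfinal : ∀ (F : Finset E) (G : E → Finset V), (∀ e ∈ F, G e ⊆ H e ∧ #(G e) = r t) →
      (Fintype.card E : ℝ) ≤ 2 * #F →
      bmean (3 / 4 * (C * ℓ * q)) univ (missIndicator F G) ≤ δ) :
    1 - probContainsEdge H m ≤
      2 * δ + 6 * (ℓ : ℝ) ^ 2 * (C / 4) ^ (-((r t : ℝ) / 2)) := by
  have hne := h.nonempty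
  have hq := h.q_pos
  have hℓ : (1 : ℝ) ≤ ℓ := by exact_mod_cast ht1.trans ht
  have hCq : C * q ≤ C * ℓ * q := by
    have : 0 ≤ C * q := by positivity
    nlinarith
  have ha : 0 ≤ C * q / 4 := by positivity
  have ha1 : C * q / 4 ≤ 1 := by linarith
  have hb : 0 ≤ 3 / 4 * (C * ℓ * q) := by positivity
  have hb1 : 3 / 4 * (C * ℓ * q) ≤ 1 := by linarith
  set Y : ℝ := (C / 4) ^ (-((r t : ℝ) / 2)) with hY
  have hY0 : 0 ≤ Y := Real.rpow_nonneg (by linarith) _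
  have hb2 := bmean_unionDensity_le (β := 3 * Y) ha ha1 hb hb1 hδ
    (fun i hi hit => (h.r_strictAnti i hi (by omega)).le)
    (fun i hi hit F G hFG => h.bmean_card_bad_le hC ha1 hi hit ht hFG)
    hfinal (t - 1) 1 (by omega) le_rfl univ H (fun e _ => ⟨Subset.rfl, hunif e⟩)
  obtain ⟨h0, h1, h2⟩ := unionDensity_mem ha ha1 hb hb1 (t - 1)
  set P := unionDensity (C * q / 4) (3 / 4 * (C * ℓ * q)) (t - 1)
  have htr := edgeFreeDensity_mul_le H h0 h1 m
  simp only [card_univ, sub_self, mul_zero, zero_div, add_zero] at hb2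
  have ht' : ((t - 1 : ℕ) : ℝ) ≤ ℓ - 1 := by
    rw [Nat.cast_sub ht1, Nat.cast_one]
    have : (t : ℝ) ≤ ℓ := Nat.cast_le.2 ht
    linarith
  have hP : P ≤ C * ℓ * q := by
    have := mul_le_mul_of_nonneg_right ht' ha
    nlinarith
  have hhalf : Fintype.card V * P / ((m : ℝ) + 1) ≤ 1 / 2 := by
    rw [div_le_iff₀ (by positivity)]
    have := mul_le_mul_of_nonneg_left hP (Nat.cast_nonneg (α := ℝ) (Fintype.card V))
    nlinarith
  rw [one_sub_probContainsEdge H hm]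
  have h3 : edgeFreeDensity H m * (1 / 2) ≤ δ + 2 * ((t - 1 : ℕ) : ℝ) * (3 * Y) :=
    (mul_le_mul_of_nonneg_left (by linarith) (edgeFreeDensity_nonneg H m)).trans
      (htr.trans hb2)
  -- This is `2 * (ℓ - 1) ≤ ℓ ^ 2`, from `(ℓ - 1) ^ 2 ≥ 0`.
  have h4 : 2 * ((t - 1 : ℕ) : ℝ) * (3 * Y) ≤ 3 * (ℓ : ℝ) ^ 2 * Y := by
    nlinarith [mul_nonneg (sq_nonneg ((ℓ : ℝ) - 1)) hY0, mul_le_mul_of_nonneg_right ht' hY0]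
  linarith

/-- At least half of the edges survive, so measuring against `#F` instead of `|H|` doubles `ρ`. -/
theorem IsSpread.bmean_no_edge_le (h : IsSpread H q r (ℓ + 1)) (hC : 0 < C)
    (hq1 : C * ℓ * q ≤ 1 / 2) (hℓ : 1 ≤ ℓ) {ρ : ℝ} (hρ : 0 < ρ)
    {F : Finset E} {G : E → Finset V} (hFG : ∀ e ∈ F, G e ⊆ H e ∧ #(G e) = r t)
    (hF : (Fintype.card E : ℝ) ≤ 2 * #F)
    (hsum : ∀ e ∈ F, ∑ e' ∈ F with 1 ≤ #(G e ∩ G e'),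
      (1 / (3 / 4 * (C * ℓ * q))) ^ #(G e ∩ G e') ≤ Fintype.card E * ρ) :
    bmean (3 / 4 * (C * ℓ * q)) univ (missIndicator F G) ≤
      Real.exp (-(1 / (2 * ρ))) := by
  have hne := h.nonempty
  have hN : (0 : ℝ) < Fintype.card E := Nat.cast_pos.2 Fintype.card_pos
  have hq := h.q_pos
  have hℓ' : (0 : ℝ) < ℓ := by exact_mod_cast hℓ
  refine MultiHypergraph.bmean_no_edge_le (r := r t) (by positivity) (by linarith) ?_
    (by positivity) (fun e he => (hFG e he).2) fun e he => (hsum e he).trans ?_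
  · rw [← card_pos, ← Nat.cast_pos (α := ℝ)]; linarith
  · nlinarith

end Main

end MultiHypergraph

open MultiHypergraph Finset in
/-- The size of the random set is `2Cℓq|V|`, rounded either way to an integer, and capped at `|V|`. -/
theorem mainTheorem2 {V E : Type*} [Fintype V] [DecidableEq V] [Fintype E]
    (H : E → Finset V) (q C : ℝ) (ℓ : ℕ) (r : ℕ → ℕ) (m : ℕ)
    (hℓ : 1 ≤ ℓ) (hr : r (ℓ + 1) = 1)
    (hunif : MultiHypergraph.IsUniform H (r 1))
    (hspread : MultiHypergraph.IsSpread H q r (ℓ + 1))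
    (hC : 8 ≤ C)
    (hm : m = min ⌊2 * C * ℓ * q * (Fintype.card V : ℝ)⌋₊ (Fintype.card V) ∨
      m = min ⌈2 * C * ℓ * q * (Fintype.card V : ℝ)⌉₊ (Fintype.card V)) :
    1 - 6 * (ℓ : ℝ) ^ 2 * (C / 4) ^ (-((r ℓ : ℝ) / 2)) - 40 / (C * ℓ)
        ≤ MultiHypergraph.probContainsEdge H m ∧
    ∀ i : ℕ, 1 ≤ i → i ≤ ℓ → 4 * (r i : ℝ) ≤ C * ℓ →
      1 - 6 * (ℓ : ℝ) ^ 2 * (C / 4) ^ (-((r i : ℝ) / 2))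
          - 2 * Real.exp (-(C * ℓ) / (4 * (r i : ℝ)))
        ≤ MultiHypergraph.probContainsEdge H m := by
  classical
  have hne := hspread.nonempty
  have hq := hspread.q_pos
  have hℓ1 : (1 : ℝ) ≤ ℓ := by exact_mod_cast hℓ
  have hC0 : 0 < C := by linarith
  have hCℓ : 8 ≤ C * ℓ := by nlinarith
  have hCℓ0 : 0 < C * ℓ := by linarith
  have hY0 : ∀ i, 0 ≤ 6 * (ℓ : ℝ) ^ 2 * (C / 4) ^ (-((r i : ℝ) / 2)) := fun i =>
    mul_nonneg (by positivity) (Real.rpow_nonneg (by linarith) _)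
  by_cases hmV : m = Fintype.card V
  · rw [hmV, probContainsEdge_card]
    refine ⟨?_, fun i _ _ _ => ?_⟩
    · have : 0 ≤ 40 / (C * ℓ) := by positivity
      linarith [hY0 ℓ]
    · linarith [hY0 i, Real.exp_pos (-(C * ℓ) / (4 * (r i : ℝ)))]
  set x : ℝ := 2 * C * ℓ * q * Fintype.card V with hx
  have hx0 : 0 ≤ x := by positivity
  -- Since the cap is not reached, `x < |V|`, which forces `C * ℓ * q ≤ 1 / 2`; either rounding
  -- gives `x ≤ m + 1`.
  have hmx : m < Fintype.card V ∧ x ≤ m + 1 ∧ x < Fintype.card V := by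
    rcases hm with hm | hm
    · have h1 : m = ⌊x⌋₊ := by omega
      have h2 : m < Fintype.card V := by omega
      exact ⟨h2, by rw [h1]; exact (Nat.lt_floor_add_one x).le,
        (Nat.floor_lt hx0).1 (h1 ▸ h2)⟩
    · have h1 : m = ⌈x⌉₊ := by omega
      have h2 : m < Fintype.card V := by omega
      have h3 : x ≤ m := by rw [h1]; exact Nat.le_ceil x
      exact ⟨h2, by linarith, h3.trans_lt (Nat.cast_lt.2 h2)⟩
  obtain ⟨hmlt, hxm, hxV⟩ := hmx
  have hq1 : C * ℓ * q ≤ 1 / 2 := by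
    have hn : (0 : ℝ) < Fintype.card V := by
      exact_mod_cast (Nat.zero_le m).trans_lt hmlt
    have : (2 * C * ℓ * q) * Fintype.card V ≤ 1 * Fintype.card V := by rw [one_mul]; exact hxV.le
    linarith [le_of_mul_le_mul_right this hn]
  have hp0 : 0 < 3 / 4 * (C * ℓ * q) := by positivity
  have hqp : q / (3 / 4 * (C * ℓ * q)) = 4 / (3 * (C * ℓ)) := by field_simp
  have hN : (0 : ℝ) ≤ Fintype.card E := Nat.cast_nonneg _
  refine ⟨?_, fun i hi1 hiℓ hri => ?_⟩
  · have hy : 4 / (3 * (C * ℓ)) ≤ 1 / 2 := by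
      rw [div_le_iff₀ (by positivity)]; linarith
    -- All stages are run: since `r (ℓ + 1) = 1`, the spread condition at index `ℓ` controls every
    -- intersecting pair.
    have h1 := hspread.one_sub_probContainsEdge_le (t := ℓ) hunif hC hℓ le_rfl
      (Real.exp_pos (-(1 / (2 * (2 * (4 / (3 * (C * ℓ)))))))).le hmlt.le hq1 hxm
      fun F G hFG hF => hspread.bmean_no_edge_le hC0 hq1 hℓ (by positivity) hFG hF
        fun e he => by
          have := sum_pow_card_inter_le (k := 1) hp0 hq (by rw [hqp]; exact hy) hN
            fun j hj => hspread.card_meet_le hℓ (Nat.lt_succ_self ℓ) hFG he (hr.trans_le hj)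
          rwa [hqp, pow_one] at this
    set ρ : ℝ := 2 * (2 * (4 / (3 * (C * ℓ)))) with hρ
    have hρ0 : 0 < ρ := by positivity
    have h2 : Real.exp (-(1 / ρ)) ≤ ρ := by
      rw [Real.exp_neg, inv_le_comm₀ (Real.exp_pos _) hρ0, ← one_div]
      linarith [Real.add_one_le_exp (1 / ρ)]
    have h3 : 2 * ρ ≤ 40 / (C * ℓ) := by
      have : 2 * ρ = (32 / 3) / (C * ℓ) := by rw [hρ]; field_simp; norm_num
      rw [this]
      gcongr
      norm_num
    linarith
  · have hr0 : (0 : ℝ) < r i := Nat.cast_pos.2 (hspread.r_pos i hi1 (by omega))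
    set u : ℝ := r i * (4 / (3 * (C * ℓ))) with hu
    have hu0 : 0 < u := by positivity
    have hu3 : u ≤ 1 / 3 := by
      rw [hu, mul_div_assoc', div_le_iff₀ (by positivity)]; linarith
    have hpow : (1 + 4 / (3 * (C * ℓ))) ^ r i - 1 ≤ 2 * r i / (C * ℓ) := by
      have h1 : (1 + 4 / (3 * (C * ℓ))) ^ r i ≤ Real.exp u := by
        rw [hu, Real.exp_nat_mul]
        refine pow_le_pow_left₀ (by positivity) ?_ _
        linarith [Real.add_one_le_exp (4 / (3 * (C * ℓ)))]
      -- From `exp u ≤ 1 / (1 - u)` and `u ≤ 1 / 3`, the latter being where `4 * r i ≤ C * ℓ`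
      -- enters.
      have h2 : Real.exp u ≤ 1 + 3 / 2 * u := by
        have h3 : 1 - u ≤ Real.exp (-u) := by linarith [Real.add_one_le_exp (-u)]
        have h4 : Real.exp u * Real.exp (-u) = 1 := by rw [← Real.exp_add]; simp
        have h5 := mul_le_mul_of_nonneg_left h3 (Real.exp_pos u).le
        by_contra hlt
        nlinarith
      have h3 : 2 * r i / (C * ℓ) = 3 / 2 * u := by rw [hu]; field_simp; norm_num
      rw [h3]; linarith
    have h1 := hspread.one_sub_probContainsEdge_le (t := i) hunif hC hi1 hiℓ
      (Real.exp_pos (-(1 / (2 * (2 * r i / (C * ℓ)))))).le hmlt.le hq1 hxm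
      fun F G hFG hF => hspread.bmean_no_edge_le hC0 hq1 hℓ (by positivity) hFG hF
        fun e he => by
          have := sum_pow_card_inter_le_of_card_le (F := F) (G := G) (A := G e) (q := q)
            (N := Fintype.card E) hp0 fun B hB hBne => by
              refine le_trans (Nat.cast_le.2 (card_le_card fun e' he' => ?_))
                (hspread.degree_le hℓ hr hBne ?_)
              · obtain ⟨h2, h3⟩ := mem_filter.1 he'
                exact mem_filter.2 ⟨mem_univ _, h3.trans (hFG e' h2).1⟩
              · exact (card_le_card hB).trans ((hFG e he).2.le.trans
                  (hspread.le_of_le le_rfl hi1 (by omega)))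
          rw [hqp, (hFG e he).2] at this
          exact this.trans (mul_le_mul_of_nonneg_left hpow hN)
    have h2 : -(1 / (2 * (2 * r i / (C * ℓ)))) = -(C * ℓ) / (4 * (r i : ℝ)) := by
      field_simp; norm_num
    rw [h2] at h1
    linarith
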